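/- The power graph $\mathcal{P}(G)$ of a group $G$ is the simple graph with vertex set $G$ in which two distinct vertices are adjacent whenever one of them is a positive power of the other; $\deg(x)$ denotes the degree of $x\in G$ in $\mathcal{P}(G)$ and $\delta(\mathcal{P}(G))$ the minimum degree of $\mathcal{P}(G)$. For a group $H$, let $\mathcal{M}(H)$ be the set of maximal cyclic subgroups of $H$, that is, of those cyclic subgroups of $H$ that are not properly contained in any cyclic subgroup of $H$; an element of $\mathcal{M}(H)$ is said to be of minimum order if its order is the least among the orders of the elements of $\mathcal{M}(H)$. Let $G$ be a finite noncyclic abelian group whose order has exactly two distinct prime divisors $p_1<p_2$, and let $P_i$ be the Sylow $p_i$-subgroup of $G$ for $i\in\{1,2\}$. Then the following hold: (i) If both $P_1$ and $P_2$ are noncyclic, then $\delta(\mathcal{P}(G))=\deg(y)$ for every $y\in G$ such that $\langle y\rangle\in\mathcal{M}(G)$ is of minimum order. (ii) If $P_1$ is noncyclic and $P_2$ is cyclic, then $\delta(\mathcal{P}(G))=\deg(y_1)$ for every $y_1\in P_1$ such that $\langle y_1\rangle\in\mathcal{M}(P_1)$ is of minimum order. (iii) If $P_1$ is cyclic and $P_2$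 is noncyclic, then $\delta(\mathcal{P}(G))=\deg(y_2)$ for every $y_2\in P_2$ such that $\langle y_2\rangle\in\mathcal{M}(P_2)$ is of minimum order. -/

import Mathlib

/-- The power graph of a group `G`: the vertices are the elements of `G`, and two distinct
vertices are adjacent when one of them is a positive power of the other. -/
def powerGraph (G : Type*) [Group G] : SimpleGraph G where
  Adj x y := x ≠ y ∧ ((∃ k : ℕ, 0 < k ∧ y = x ^ k) ∨ ∃ k : ℕ, 0 < k ∧ x = y ^ k)
  symm := ⟨fun _ _ h => ⟨h.1.symm, h.2.symm⟩⟩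
  loopless := ⟨fun _ h => h.1 rfl⟩

/-- The collection of all maximal cyclic subgroups of `G`: the cyclic subgroups of `G` that are
not properly contained in any cyclic subgroup of `G`. -/
def maximalCyclicSubgroups (G : Type*) [Group G] : Set (Subgroup G) :=
  {M | Maximal (fun K : Subgroup G => IsCyclic K) M}

/-- `M` is a maximal cyclic subgroup of `G` whose order is minimum among the orders of all
maximal cyclic subgroups of `G`. -/
def IsMinOrderMaximalCyclic {G : Type*} [Group G] (M : Subgroup G) : Prop :=
  M ∈ maximalCyclicSubgroups G ∧ ∀ K ∈ maximalCyclicSubgroups G, Nat.card M ≤ Nat.card K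

/-! Inclusion-exclusion gives deg(x) + 1 = o(x) + c(x) - φ(o(x)), where c(x) = `coverCount x` counts
the z with x ∈ ⟨z⟩. Both o and c are multiplicative over G = P₁ × P₂, and c(x) = φ(o(x)) when ⟨x⟩ is
maximal cyclic, so then deg(x) = o(x) - 1. It remains to bound c below on a noncyclic abelian
p-group. If a ∈ ⟨c⟩ with ⟨c⟩ maximal cyclic, some t of order p lies outside ⟨c⟩, and each product of
an element of ⟨c⟩ \ ⟨a⟩ with a power of t still has a among its powers; hence c(a) ≥ φ(o(a)) +
p(o(c) - o(a)). On a cyclic p-group the same argument without t has factor 1. Elementary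
inequalities turn these bounds into the claims; (iii) is (ii) with the factors swapped. -/

open Subgroup

/-! ### Degrees through covers; direct products of coprime order -/

section Covers

variable {G H : Type*} [Group G] [Group H]

/-- The number of elements of `G` having `x` among their powers. -/
noncomputable def coverCount (x : G) : ℕ := {z : G | x ∈ zpowers z}.ncard

theorem coverCount_one [Finite G] : coverCount (1 : G) = Nat.card G := by
  simp [coverCount, one_mem, Set.ncard_univ]

theorem coverCount_mulEquiv (e : G ≃* H) (x : G) : coverCount (e x) = coverCount x := by
  have h : {z : H | e x ∈ zpowers z} = e '' {z : G | x ∈ zpowers z} := by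
    ext z
    obtain ⟨z, rfl⟩ := e.surjective z
    simp [mem_zpowers_iff, ← map_zpow]
  rw [coverCount, h, Set.InjOn.ncard_image e.injective.injOn, coverCount]

theorem ncard_zpowers (x : G) : (zpowers x : Set G).ncard = orderOf x := by
  rw [← Nat.card_zpowers]; rfl

theorem ncard_zpowers_eq_zpowers [Finite G] (x : G) :
    {z : G | zpowers z = zpowers x}.ncard = (orderOf x).totient := by
  classical
  have := Fintype.ofFinite G
  have h : {z : G | zpowers z = zpowers x} =
      (↑) '' {a : zpowers x | orderOf a = orderOf x} := by
    ext z
    simp only [Set.mem_ofPred_eq, Set.mem_image, Subtype.exists, ← Subgroup.orderOf_coe,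
      exists_and_left, exists_prop]
    constructor
    · intro h
      exact ⟨z, by rw [← Nat.card_zpowers, h, Nat.card_zpowers], h ▸ mem_zpowers z, rfl⟩
    · rintro ⟨z, ho, hz, rfl⟩
      exact eq_of_le_of_card_ge (zpowers_le.2 hz) (by rw [Nat.card_zpowers, Nat.card_zpowers, ho])
  rw [h, Set.InjOn.ncard_image Subtype.val_injective.injOn, Set.ncard_eq_toFinset_card',
    Set.toFinset_ofPred]
  exact IsCyclic.card_orderOf_eq_totient (by rw [← Nat.card_eq_fintype_card, Nat.card_zpowers])

theorem exists_pos_pow_eq_iff_mem_zpowers [Finite G] {x y : G} :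
    (∃ k : ℕ, 0 < k ∧ y = x ^ k) ↔ y ∈ zpowers x := by
  constructor
  · rintro ⟨k, -, rfl⟩
    exact npow_mem_zpowers x k
  · intro h
    obtain ⟨k, rfl⟩ := mem_powers_iff_mem_zpowers.2 h
    -- Adding the order makes the exponent positive even when k = 0.
    exact ⟨k + orderOf x, Nat.add_pos_right _ (orderOf_pos x), by simp [pow_add]⟩

theorem powerGraph_degree [Fintype G] [DecidableRel (powerGraph G).Adj] (x : G) :
    (powerGraph G).degree x + 1 + (orderOf x).totient = orderOf x + coverCount x := by
  classical
  have hN : (insert x ((powerGraph G).neighborFinset x) : Set G) =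
      (zpowers x : Set G) ∪ {z | x ∈ zpowers z} := by
    ext z
    have hadj : (powerGraph G).Adj x z ↔ x ≠ z ∧ (z ∈ zpowers x ∨ x ∈ zpowers z) := by
      simp only [powerGraph, exists_pos_pow_eq_iff_mem_zpowers]
    simp only [SimpleGraph.coe_neighborFinset, Set.mem_insert_iff, SimpleGraph.mem_neighborSet,
      hadj, Set.mem_union, SetLike.mem_coe, Set.mem_ofPred_eq]
    constructor
    · rintro (rfl | h)
      · exact Or.inl (mem_zpowers z)
      · exact h.2
    · intro h
      by_cases hz : z = x
      · exact Or.inl hz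
      · exact Or.inr ⟨fun h => hz h.symm, h⟩
  -- The overlap consists of the generators of ⟨x⟩, whence the totient.
  have hI : (zpowers x : Set G) ∩ {z | x ∈ zpowers z} = {z | zpowers z = zpowers x} := by
    ext z
    simp [le_antisymm_iff, zpowers_le]
  have hcard := Set.ncard_union_add_ncard_inter (zpowers x : Set G) {z | x ∈ zpowers z}
  rw [hI, ← hN, ncard_zpowers_eq_zpowers, ncard_zpowers, ← Finset.coe_insert,
    Set.ncard_coe_finset, Finset.card_insert_of_notMem (by simp),
    SimpleGraph.card_neighborFinset_eq_degree] at hcard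
  exact hcard

theorem maximal_isCyclic_zpowers_iff {x : G} :
    Maximal (fun K : Subgroup G => IsCyclic K) (zpowers x) ↔
      ∀ z : G, x ∈ zpowers z → z ∈ zpowers x := by
  constructor
  · intro h z hz
    exact h.2 (y := zpowers z) inferInstance (zpowers_le.2 hz) (mem_zpowers z)
  · refine fun h => ⟨inferInstance, fun K hK hxK => ?_⟩
    obtain ⟨z, rfl⟩ := (Subgroup.isCyclic_iff_exists_zpowers_eq_top K).1 hK
    exact zpowers_le.2 (h z (hxK (mem_zpowers x)))

theorem exists_maximal_isCyclic_zpowers [Finite G] (x : G) :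
    ∃ z : G, x ∈ zpowers z ∧ Maximal (fun K : Subgroup G => IsCyclic K) (zpowers z) := by
  obtain ⟨K, hxK, hK⟩ := Finite.exists_le_maximal (p := fun K : Subgroup G => IsCyclic K)
    (a := zpowers x) inferInstance
  obtain ⟨z, rfl⟩ := (Subgroup.isCyclic_iff_exists_zpowers_eq_top K).1 hK.1
  exact ⟨z, hxK (mem_zpowers x), hK⟩

theorem coverCount_of_maximal [Finite G] {x : G}
    (h : Maximal (fun K : Subgroup G => IsCyclic K) (zpowers x)) :
    coverCount x = (orderOf x).totient := by
  rw [← ncard_zpowers_eq_zpowers, coverCount]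
  congr 1
  ext z
  simp only [Set.mem_ofPred_eq, le_antisymm_iff, zpowers_le]
  exact ⟨fun hz => ⟨maximal_isCyclic_zpowers_iff.1 h z hz, hz⟩, fun hz => hz.2⟩

theorem mem_zpowers_prod_iff [Finite G] [Finite H] (hco : (Nat.card G).Coprime (Nat.card H))
    {x z : G × H} : x ∈ zpowers z ↔ x.1 ∈ zpowers z.1 ∧ x.2 ∈ zpowers z.2 := by
  constructor
  · rintro ⟨k, rfl⟩
    exact ⟨⟨k, rfl⟩, ⟨k, rfl⟩⟩
  · rintro ⟨h₁, h₂⟩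
    obtain ⟨i, hi⟩ := mem_powers_iff_mem_zpowers.2 h₁
    obtain ⟨j, hj⟩ := mem_powers_iff_mem_zpowers.2 h₂
    obtain ⟨k, hk₁, hk₂⟩ := Nat.chineseRemainder hco i j
    refine ⟨k, Prod.ext ?_ ?_⟩
    · simp only [zpow_natCast, Prod.pow_fst, ← hi]
      exact pow_eq_pow_iff_modEq.2 (hk₁.of_dvd (orderOf_dvd_natCard _))
    · simp only [zpow_natCast, Prod.pow_snd, ← hj]
      exact pow_eq_pow_iff_modEq.2 (hk₂.of_dvd (orderOf_dvd_natCard _))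

theorem coverCount_prod [Finite G] [Finite H] (hco : (Nat.card G).Coprime (Nat.card H))
    (x : G × H) : coverCount x = coverCount x.1 * coverCount x.2 := by
  rw [coverCount, coverCount, coverCount, ← Set.ncard_prod]
  congr 1
  ext z
  simp [mem_zpowers_prod_iff hco]

theorem orderOf_prod_of_coprime_card [Finite G] [Finite H]
    (hco : (Nat.card G).Coprime (Nat.card H)) (x : G × H) :
    orderOf x = orderOf x.1 * orderOf x.2 := by
  rw [Prod.orderOf]
  exact ((hco.coprime_dvd_left (orderOf_dvd_natCard _)).coprime_dvd_right
    (orderOf_dvd_natCard _)).lcm_eq_mul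

theorem maximal_isCyclic_zpowers_fst [Finite G] [Finite H]
    (hco : (Nat.card G).Coprime (Nat.card H)) {x : G × H}
    (h : Maximal (fun K : Subgroup (G × H) => IsCyclic K) (zpowers x)) :
    Maximal (fun K : Subgroup G => IsCyclic K) (zpowers x.1) := by
  rw [maximal_isCyclic_zpowers_iff] at h ⊢
  intro z hz
  exact ((mem_zpowers_prod_iff hco).1
    (h (z, x.2) ((mem_zpowers_prod_iff hco).2 ⟨hz, mem_zpowers _⟩))).1

theorem maximal_isCyclic_zpowers_snd [Finite G] [Finite H]
    (hco : (Nat.card G).Coprime (Nat.card H)) {x : G × H}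
    (h : Maximal (fun K : Subgroup (G × H) => IsCyclic K) (zpowers x)) :
    Maximal (fun K : Subgroup H => IsCyclic K) (zpowers x.2) := by
  rw [maximal_isCyclic_zpowers_iff] at h ⊢
  intro z hz
  exact ((mem_zpowers_prod_iff hco).1
    (h (x.1, z) ((mem_zpowers_prod_iff hco).2 ⟨mem_zpowers _, hz⟩))).2

theorem maximal_isCyclic_zpowers_mulEquiv (e : G ≃* H) {x : G} :
    Maximal (fun K : Subgroup H => IsCyclic K) (zpowers (e x)) ↔
      Maximal (fun K : Subgroup G => IsCyclic K) (zpowers x) := by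
  have key (a b : G) : e a ∈ zpowers (e b) ↔ a ∈ zpowers b := by
    simp [mem_zpowers_iff, ← map_zpow]
  simp only [maximal_isCyclic_zpowers_iff, ← key, e.surjective.forall]

end Covers

/-! ### Lower bounds for covers in abelian p-groups -/

section PGroup

variable {G : Type*} {p : ℕ} [hp : Fact p.Prime]

theorem IsPGroup.mem_zpowers_pow [Group G] (hG : IsPGroup p G) (x : G) {k : ℕ} (hk : ¬ p ∣ k) :
    x ∈ zpowers (x ^ k) :=
  mem_zpowers_pow_iff.2
    (hG.orderOf_coprime ((Nat.Prime.coprime_iff_not_dvd hp.out).2 hk) x).symm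

/-- In a cyclic `p`-group, an element outside `⟨a⟩` has `a` among the powers of its
`p`-th power. -/
theorem IsPGroup.mem_zpowers_pow_of_notMem_zpowers [Group G] [Finite G] (hG : IsPGroup p G)
    {a c z : G} (ha : a ∈ zpowers c) (hz : z ∈ zpowers c) (hza : z ∉ zpowers a) :
    a ∈ zpowers (z ^ p) := by
  obtain ⟨i, rfl⟩ := mem_powers_iff_mem_zpowers.2 ha
  obtain ⟨j, rfl⟩ := mem_powers_iff_mem_zpowers.2 hz
  simp only at hza ⊢
  rcases eq_or_ne i 0 with rfl | hi
  · simp [one_mem]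
  rcases eq_or_ne j 0 with rfl | hj
  · simp [one_mem] at hza
  obtain ⟨α, i, hi', rfl⟩ := Nat.exists_eq_pow_mul_and_not_dvd hi p hp.out.ne_one
  obtain ⟨β, j, hj', rfl⟩ := Nat.exists_eq_pow_mul_and_not_dvd hj p hp.out.ne_one
  -- Subgroups of ⟨c⟩ form a chain indexed by p-adic valuations of exponents; z ∉ ⟨a⟩ makes ⟨a⟩
  -- strictly smaller than ⟨z⟩, hence contained in ⟨z ^ p⟩.
  have hlt : β < α := by
    by_contra! hle
    refine hza ?_
    have h := hG.mem_zpowers_pow (c ^ p ^ α) hi'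
    rw [← pow_mul] at h
    obtain ⟨γ, rfl⟩ := Nat.exists_eq_add_of_le hle
    rw [pow_add, mul_assoc, pow_mul c (p ^ α) (p ^ γ * j)]
    exact pow_mem h _
  have h := hG.mem_zpowers_pow (c ^ p ^ (β + 1)) hj'
  obtain ⟨γ, rfl⟩ := Nat.exists_eq_add_of_le (Nat.succ_le_of_lt hlt)
  have e₁ : (c ^ (p ^ β * j)) ^ p = (c ^ p ^ (β + 1)) ^ j := by
    rw [← pow_mul, ← pow_mul]; ring_nf
  rw [e₁, Nat.succ_eq_add_one, pow_add p (β + 1), mul_assoc, pow_mul c (p ^ (β + 1)) (p ^ γ * i)]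
  exact pow_mem h _

/-- Otherwise ⟨c⟩ would be closed under p-th roots, hence all of G. Given x ^ p = c ^ m: if p ∣ m,
then x differs from a power of c by p-torsion; if not, c is a power of x and maximality applies. -/
theorem IsPGroup.exists_pow_eq_one_notMem_zpowers [CommGroup G] [Finite G] (hG : IsPGroup p G)
    (hcyc : ¬ IsCyclic G) {c : G}
    (hc : Maximal (fun K : Subgroup G => IsCyclic K) (zpowers c)) :
    ∃ t : G, t ^ p = 1 ∧ t ∉ zpowers c := by
  classical
  by_contra! h
  refine hcyc ⟨c, fun x => ?_⟩
  change x ∈ zpowers c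
  have step (x : G) (hx : x ^ p ∈ zpowers c) : x ∈ zpowers c := by
    obtain ⟨m, hm⟩ := mem_powers_iff_mem_zpowers.2 hx
    simp only at hm
    by_cases hpm : p ∣ m
    · obtain ⟨m, rfl⟩ := hpm
      have ht := h (x * (c ^ m)⁻¹) (by
        rw [mul_pow, ← hm, inv_pow, ← pow_mul, mul_comm m p, mul_inv_cancel])
      simpa using mul_mem ht (npow_mem_zpowers c m)
    · refine maximal_isCyclic_zpowers_iff.1 hc x ?_
      have := hG.mem_zpowers_pow c hpm
      rw [hm] at this
      exact zpowers_le.2 (npow_mem_zpowers x p) this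
  obtain ⟨k, hk⟩ := hG x
  have hmem : x ^ p ^ k ∈ zpowers c := hk ▸ one_mem _
  clear hk
  induction k with
  | zero => simpa using hmem
  | succ k ih => exact ih (step _ (by rwa [← pow_mul, ← pow_succ]))

/-- Translating `⟨c⟩ \ ⟨a⟩` by an elementary abelian subgroup that is independent of `⟨c⟩` yields
elements having `a` among their powers. -/
theorem IsPGroup.totient_add_card_mul_le_coverCount [CommGroup G] [Finite G] (hG : IsPGroup p G)
    {a c : G} (ha : a ∈ zpowers c) (T : Subgroup G) (hT : ∀ t ∈ T, t ^ p = 1)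
    (hd : Disjoint (zpowers c) T) :
    (orderOf a).totient + Nat.card T * (orderOf c - orderOf a) ≤ coverCount a := by
  have hac : (zpowers a : Set G) ⊆ zpowers c := zpowers_le.2 ha
  set S : Set (G × G) := ((zpowers c : Set G) \ zpowers a) ×ˢ (T : Set G) with hS
  have hinj : Set.InjOn (fun w : G × G => w.1 * w.2) S := by
    rintro ⟨z, t⟩ ⟨⟨hz, -⟩, ht⟩ ⟨z', t'⟩ ⟨⟨hz', -⟩, ht'⟩ h
    have := Subgroup.mul_injective_of_disjoint hd
      (a₁ := (⟨z, hz⟩, ⟨t, ht⟩)) (a₂ := (⟨z', hz'⟩, ⟨t', ht'⟩)) h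
    simpa using this
  have hcardS : ((fun w : G × G => w.1 * w.2) '' S).ncard =
      Nat.card T * (orderOf c - orderOf a) := by
    rw [hinj.ncard_image, hS, Set.ncard_prod, Set.ncard_sdiff hac, ncard_zpowers, ncard_zpowers,
      mul_comm]
    rfl
  have hdisj : Disjoint {z : G | zpowers z = zpowers a} ((fun w : G × G => w.1 * w.2) '' S) := by
    rw [Set.disjoint_left]
    rintro _ hz ⟨⟨z, t⟩, ⟨⟨hzc, hza⟩, ht⟩, rfl⟩
    have hzt : z * t ∈ zpowers a := by
      rw [← show zpowers (z * t) = zpowers a from hz]; exact mem_zpowers _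
    have htc : t ∈ zpowers c := by simpa using mul_mem (inv_mem hzc) (hac hzt)
    have ht1 : t = 1 := Subgroup.disjoint_def.1 hd htc ht
    exact hza (by simpa [ht1] using hzt)
  rw [← hcardS, ← ncard_zpowers_eq_zpowers, ← Set.ncard_union_eq hdisj, coverCount]
  refine Set.ncard_le_ncard (Set.union_subset ?_ ?_)
  · intro z hz
    change a ∈ zpowers z
    rw [show zpowers z = zpowers a from hz]
    exact mem_zpowers a
  · rintro _ ⟨⟨z, t⟩, ⟨⟨hzc, hza⟩, ht⟩, rfl⟩
    have h := hG.mem_zpowers_pow_of_notMem_zpowers ha hzc hza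
    -- The p-th power kills t, so a ∈ ⟨z ^ p⟩ lies in ⟨z * t⟩.
    have e : z ^ p = (z * t) ^ p := by rw [mul_pow, hT t ht, mul_one]
    rw [e] at h
    exact zpowers_le.2 (npow_mem_zpowers _ p) h

theorem IsPGroup.totient_add_mul_le_coverCount_of_maximal [CommGroup G] [Finite G]
    (hG : IsPGroup p G) (hcyc : ¬ IsCyclic G) {a c : G} (ha : a ∈ zpowers c)
    (hc : Maximal (fun K : Subgroup G => IsCyclic K) (zpowers c)) :
    (orderOf a).totient + p * (orderOf c - orderOf a) ≤ coverCount a := by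
  obtain ⟨t, ht, htc⟩ := hG.exists_pow_eq_one_notMem_zpowers hcyc hc
  have hord : orderOf t = p := orderOf_eq_prime ht (by rintro rfl; exact htc (one_mem _))
  have hd : Disjoint (zpowers c) (zpowers t) := by
    rw [Subgroup.disjoint_def]
    intro s hsc hst
    obtain ⟨k, rfl⟩ := mem_powers_iff_mem_zpowers.2 hst
    by_cases hk : p ∣ k
    · obtain ⟨k, rfl⟩ := hk
      simp [pow_mul, ht]
    · exact absurd (zpowers_le.2 hsc (hG.mem_zpowers_pow t hk)) htc
  have := hG.totient_add_card_mul_le_coverCount ha (zpowers t) (by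
    rintro _ ⟨k, rfl⟩
    rw [← zpow_natCast, zpow_comm, zpow_natCast, ht, one_zpow]) hd
  rwa [Nat.card_zpowers, hord] at this

theorem IsPGroup.totient_add_le_coverCount_of_isCyclic [CommGroup G] [Finite G] [IsCyclic G]
    (hG : IsPGroup p G) (a : G) :
    (orderOf a).totient + (Nat.card G - orderOf a) ≤ coverCount a := by
  obtain ⟨c, hc⟩ := IsCyclic.exists_generator (α := G)
  have := hG.totient_add_card_mul_le_coverCount (hc a) ⊥ (by simp) disjoint_bot_right
  rwa [Subgroup.card_bot, one_mul, orderOf_eq_card_of_forall_mem_zpowers hc] at this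

end PGroup

/-! ### Numerical inequalities -/

section Arithmetic

theorem Nat.Prime.pow_le_mul_totient {p q : ℕ} (hp : p.Prime) (hq : 2 ≤ q) (i : ℕ) :
    p ^ i ≤ q * (p ^ i).totient := by
  rcases i with - | i
  · simp; omega
  · rw [Nat.totient_prime_pow_succ hp, pow_succ, mul_left_comm]
    refine Nat.mul_le_mul_left _ ?_
    obtain ⟨r, rfl⟩ := Nat.exists_eq_add_of_le hp.two_le
    rw [show 2 + r - 1 = r + 1 by omega]
    nlinarith

/-- The difference p ^ i - φ(p ^ i) is 0 for i = 0 and p ^ (i - 1) otherwise, so it is monotone in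
i. -/
theorem Nat.Prime.pow_add_totient_le {p i j : ℕ} (hp : p.Prime) (hij : p ^ i ≤ p ^ j) :
    p ^ i + (p ^ j).totient ≤ p ^ j + (p ^ i).totient := by
  have h (k : ℕ) : p ^ (k + 1) = p ^ k + (p ^ (k + 1)).totient := by
    obtain ⟨r, rfl⟩ := Nat.exists_eq_add_of_le hp.two_le
    rw [Nat.totient_prime_pow_succ hp, show 2 + r - 1 = r + 1 by omega]
    ring
  have hle : i ≤ j := (Nat.pow_le_pow_iff_right hp.one_lt).1 hij
  rcases i with - | i
  · have := Nat.totient_le (p ^ j)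
    simp; omega
  · obtain ⟨j, rfl⟩ : ∃ k, j = k + 1 := ⟨j - 1, by omega⟩
    have := h i
    have := h j
    have : p ^ i ≤ p ^ j := Nat.pow_le_pow_right hp.pos (by omega)
    omega

/-- For (i): u, v are the orders of the components of x, f, g their totients, A, B their covers, and
w, s the orders of the maximal cyclic subgroups above. Expanding A * B, the cross terms dominate
those of w * s = (u + X)(v + Y). -/
theorem mul_add_mul_le_of_le_covers {p q u v w s f g A B : ℕ} (hp : 0 < p) (hq : 0 < q)
    (huw : u ≤ w) (hvs : v ≤ s) (hf : u ≤ q * f) (hg : v ≤ p * g)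
    (hA : f + p * (w - u) ≤ A) (hB : g + q * (s - v) ≤ B) :
    w * s + f * g ≤ u * v + A * B := by
  obtain ⟨X, rfl⟩ := Nat.exists_eq_add_of_le huw
  obtain ⟨Y, rfl⟩ := Nat.exists_eq_add_of_le hvs
  rw [Nat.add_sub_cancel_left] at hA hB
  have h := Nat.mul_le_mul hA hB
  have h₁ := Nat.mul_le_mul_right Y hf
  have h₂ := Nat.mul_le_mul_right X hg
  have h₃ : 1 * (X * Y) ≤ (p * q) * (X * Y) := Nat.mul_le_mul_right _ (Nat.mul_pos hp hq)
  nlinarith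

/-- For (ii): here w₀, k₀ are the order and totient of y, w, k those of a maximal cyclic subgroup
above the first component of x, and n is the order of the cyclic factor. -/
theorem add_mul_add_mul_le_of_le_covers {p u v w w₀ n f g k k₀ A B : ℕ} (hp : 0 < p)
    (hv : 0 < v) (huw : u ≤ w) (hvn : v ≤ n) (hf : f ≤ u) (hg : v ≤ p * g)
    (huk : u + k ≤ w + f) (hwk : w₀ + k ≤ w + k₀) (hk : k₀ ≤ k)
    (hA : f + p * (w - u) ≤ A) (hB : g + (n - v) ≤ B) :
    w₀ + k₀ * n + f * g ≤ u * v + A * B + k₀ := by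
  obtain ⟨X, rfl⟩ := Nat.exists_eq_add_of_le huw
  obtain ⟨Z, rfl⟩ := Nat.exists_eq_add_of_le hvn
  rw [Nat.add_sub_cancel_left] at hA hB
  obtain ⟨r, rfl⟩ := Nat.exists_eq_add_of_le hf
  obtain ⟨m, rfl⟩ := Nat.exists_eq_add_of_le hk
  obtain ⟨v, rfl⟩ : ∃ v', v = v' + 1 := ⟨v - 1, by omega⟩
  have h := Nat.mul_le_mul hA hB
  have h₁ := Nat.mul_le_mul_right X hg
  have h₂ : 1 * (X * Z) ≤ p * (X * Z) := Nat.mul_le_mul_right _ hp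
  have h₃ : (k₀ + m) * (v + Z) ≤ (X + f) * (v + Z) := Nat.mul_le_mul_right _ (by omega)
  have h₄ : 0 ≤ r * v := Nat.zero_le _
  have h₅ : 0 ≤ m * (v + Z) := Nat.zero_le _
  nlinarith

end Arithmetic

/-! ### Degree comparison in H × K -/

section Degree

variable {G H K : Type*} [Group G] [CommGroup H] [CommGroup K] [Fintype G] [Finite H] [Finite K]
  [DecidableRel (powerGraph G).Adj] {p q : ℕ} [hp : Fact p.Prime] [hq : Fact q.Prime]

theorem powerGraph_degree_mulEquiv_prod (hco : (Nat.card H).Coprime (Nat.card K))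
    (e : H × K ≃* G) (x : H × K) :
    (powerGraph G).degree (e x) + 1 + (orderOf x.1).totient * (orderOf x.2).totient =
      orderOf x.1 * orderOf x.2 + coverCount x.1 * coverCount x.2 := by
  have hx : (orderOf x.1).Coprime (orderOf x.2) :=
    (hco.coprime_dvd_left (orderOf_dvd_natCard _)).coprime_dvd_right (orderOf_dvd_natCard _)
  have h := powerGraph_degree (e x)
  rwa [MulEquiv.orderOf_eq, coverCount_mulEquiv, orderOf_prod_of_coprime_card hco,
    coverCount_prod hco, Nat.totient_mul hx] at h

theorem degree_le_degree_of_isMinOrderMaximalCyclic (hco : (Nat.card H).Coprime (Nat.card K))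
    (e : H × K ≃* G) (hH : IsPGroup p H) (hK : IsPGroup q K) (hHc : ¬ IsCyclic H)
    (hKc : ¬ IsCyclic K) {y : G} (hy : IsMinOrderMaximalCyclic (zpowers y)) (x : G) :
    (powerGraph G).degree y ≤ (powerGraph G).degree x := by
  obtain ⟨z, hxz, hz⟩ := exists_maximal_isCyclic_zpowers x
  obtain ⟨x, rfl⟩ := e.surjective x
  obtain ⟨z, rfl⟩ := e.surjective z
  have hyz : orderOf y ≤ orderOf z.1 * orderOf z.2 := by
    have := hy.2 _ hz
    rwa [Nat.card_zpowers, Nat.card_zpowers, MulEquiv.orderOf_eq,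
      orderOf_prod_of_coprime_card hco] at this
  rw [maximal_isCyclic_zpowers_mulEquiv] at hz
  have hxz' : x ∈ zpowers z := by
    obtain ⟨k, hk⟩ := hxz
    exact ⟨k, e.injective (by simpa using hk)⟩
  obtain ⟨h₁, h₂⟩ := (mem_zpowers_prod_iff hco).1 hxz'
  have hA := hH.totient_add_mul_le_coverCount_of_maximal hHc h₁
    (maximal_isCyclic_zpowers_fst hco hz)
  have hB := hK.totient_add_mul_le_coverCount_of_maximal hKc h₂
    (maximal_isCyclic_zpowers_snd hco hz)
  obtain ⟨i, hi⟩ := IsPGroup.iff_orderOf.1 hH x.1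
  obtain ⟨j, hj⟩ := IsPGroup.iff_orderOf.1 hK x.2
  have key := mul_add_mul_le_of_le_covers hp.out.pos hq.out.pos
    (Nat.le_of_dvd (orderOf_pos _) (orderOf_dvd_of_mem_zpowers h₁))
    (Nat.le_of_dvd (orderOf_pos _) (orderOf_dvd_of_mem_zpowers h₂))
    (hi ▸ hp.out.pow_le_mul_totient hq.out.two_le i)
    (hj ▸ hq.out.pow_le_mul_totient hp.out.two_le j) hA hB
  have hdx := powerGraph_degree_mulEquiv_prod hco e x
  have hdy := powerGraph_degree y
  rw [coverCount_of_maximal hy.1] at hdy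
  omega

theorem degree_le_degree_of_isMinOrderMaximalCyclic_fst
    (hco : (Nat.card H).Coprime (Nat.card K)) (e : H × K ≃* G) (hH : IsPGroup p H)
    (hK : IsPGroup q K) (hHc : ¬ IsCyclic H) [IsCyclic K] {y : H}
    (hy : IsMinOrderMaximalCyclic (zpowers y)) (x : G) :
    (powerGraph G).degree (e (y, 1)) ≤ (powerGraph G).degree x := by
  obtain ⟨x, rfl⟩ := e.surjective x
  obtain ⟨z, hxz, hz⟩ := exists_maximal_isCyclic_zpowers x.1
  have hyz : orderOf y ≤ orderOf z := by
    have := hy.2 _ hz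
    rwa [Nat.card_zpowers, Nat.card_zpowers] at this
  have hA := hH.totient_add_mul_le_coverCount_of_maximal hHc hxz hz
  have hB := hK.totient_add_le_coverCount_of_isCyclic x.2
  have hle : orderOf x.1 ≤ orderOf z :=
    Nat.le_of_dvd (orderOf_pos _) (orderOf_dvd_of_mem_zpowers hxz)
  obtain ⟨i, hi⟩ := IsPGroup.iff_orderOf.1 hH x.1
  obtain ⟨j, hj⟩ := IsPGroup.iff_orderOf.1 hK x.2
  obtain ⟨l, hl⟩ := IsPGroup.iff_orderOf.1 hH z
  obtain ⟨m, hm⟩ := IsPGroup.iff_orderOf.1 hH y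
  -- Both orders are powers of p, so the smaller divides the larger.
  have hml : (orderOf y).totient ≤ (orderOf z).totient := by
    rw [hl, hm] at hyz ⊢
    exact Nat.le_of_dvd (Nat.totient_pos.2 (pow_pos hp.out.pos _)) (Nat.totient_dvd_of_dvd
      (pow_dvd_pow p ((Nat.pow_le_pow_iff_right hp.out.one_lt).1 hyz)))
  have huk : orderOf x.1 + (orderOf z).totient ≤ orderOf z + (orderOf x.1).totient := by
    rw [hi, hl] at hle ⊢
    exact hp.out.pow_add_totient_le hle
  have hwk : orderOf y + (orderOf z).totient ≤ orderOf z + (orderOf y).totient := by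
    rw [hm, hl] at hyz ⊢
    exact hp.out.pow_add_totient_le hyz
  have key := add_mul_add_mul_le_of_le_covers hp.out.pos (orderOf_pos x.2) hle
    (Nat.le_of_dvd Nat.card_pos (orderOf_dvd_natCard x.2)) (Nat.totient_le _)
    (hj ▸ hq.out.pow_le_mul_totient hp.out.two_le j) huk hwk hml hA hB
  have hdx := powerGraph_degree_mulEquiv_prod hco e x
  have hdy := powerGraph_degree_mulEquiv_prod hco e (y, 1)
  simp only [orderOf_one, Nat.totient_one, mul_one, coverCount_one,
    coverCount_of_maximal hy.1] at hdy
  omega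

end Degree

theorem powerGraph_minDegree_eq_of_forall_le {G : Type*} [Group G] [Fintype G]
    [DecidableRel (powerGraph G).Adj] {y : G}
    (h : ∀ x, (powerGraph G).degree y ≤ (powerGraph G).degree x) :
    (powerGraph G).minDegree = (powerGraph G).degree y :=
  le_antisymm ((powerGraph G).minDegree_le_degree y)
    ((powerGraph G).le_minDegree_of_forall_le_degree _ h)

theorem Sylow.exists_prod_mulEquiv_of_primeFactors_eq_pair {G : Type*} [CommGroup G] [Finite G]
    {p q : ℕ} [Fact p.Prime] [Fact q.Prime] (hpq : p ≠ q)
    (hn : (Nat.card G).primeFactors = {p, q}) (P : Sylow p G) (Q : Sylow q G) :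
    ∃ e : P × Q ≃* G, ∀ x, e x = x.1 * x.2 := by
  let f : P × Q →* G := (P : Subgroup G).subtype.coprod (Q : Subgroup G).subtype
  have hinj : Function.Injective f := by
    intro x y hxy
    exact Subgroup.mul_injective_of_disjoint
      (IsPGroup.disjoint_of_ne p q hpq _ _ P.isPGroup' Q.isPGroup') hxy
  have hcard : Nat.card (P × Q) = Nat.card G := by
    have h := Nat.prod_factorization_pow_eq_self (n := Nat.card G) Nat.card_pos.ne'
    rw [Finsupp.prod, Nat.support_factorization, hn, Finset.prod_pair hpq] at h
    rw [Nat.card_prod, P.card_eq_multiplicity, Q.card_eq_multiplicity, h]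
  exact ⟨MulEquiv.ofBijective f
    ((Nat.bijective_iff_injective_and_card f).2 ⟨hinj, hcard⟩), fun x => rfl⟩

theorem corollary1p5 {G : Type*} [CommGroup G] [Fintype G] [DecidableRel (powerGraph G).Adj]
    (hG : ¬ IsCyclic G) {p₁ p₂ : ℕ} (hlt : p₁ < p₂)
    (hn : (Nat.card G).primeFactors = {p₁, p₂})
    (P₁ : Sylow p₁ G) (P₂ : Sylow p₂ G) :
    (¬ IsCyclic P₁ → ¬ IsCyclic P₂ →
      ∀ y : G, IsMinOrderMaximalCyclic (Subgroup.zpowers y) →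
        (powerGraph G).minDegree = (powerGraph G).degree y) ∧
    (¬ IsCyclic P₁ → IsCyclic P₂ →
      ∀ y₁ : P₁, IsMinOrderMaximalCyclic (Subgroup.zpowers y₁) →
        (powerGraph G).minDegree = (powerGraph G).degree (y₁ : G)) ∧
    (IsCyclic P₁ → ¬ IsCyclic P₂ →
      ∀ y₂ : P₂, IsMinOrderMaximalCyclic (Subgroup.zpowers y₂) →
        (powerGraph G).minDegree = (powerGraph G).degree (y₂ : G)) := by
  have : Fact p₁.Prime := ⟨Nat.prime_of_mem_primeFactors (n := Nat.card G) (by rw [hn]; simp)⟩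
  have : Fact p₂.Prime := ⟨Nat.prime_of_mem_primeFactors (n := Nat.card G) (by rw [hn]; simp)⟩
  obtain ⟨e, he⟩ := Sylow.exists_prod_mulEquiv_of_primeFactors_eq_pair hlt.ne hn P₁ P₂
  have hco : (Nat.card P₁).Coprime (Nat.card P₂) :=
    IsPGroup.coprime_card_of_ne p₁ p₂ hlt.ne _ _ P₁.isPGroup' P₂.isPGroup'
  refine ⟨fun h₁ h₂ y hy => ?_, fun h₁ h₂ y hy => ?_, fun h₁ h₂ y hy => ?_⟩ <;>
    refine powerGraph_minDegree_eq_of_forall_le fun x => ?_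
  · exact degree_le_degree_of_isMinOrderMaximalCyclic hco e P₁.isPGroup' P₂.isPGroup' h₁ h₂ hy x
  · have := degree_le_degree_of_isMinOrderMaximalCyclic_fst hco e P₁.isPGroup' P₂.isPGroup' h₁ hy x
    rwa [show e (y, 1) = y by simp [he]] at this
  · have := degree_le_degree_of_isMinOrderMaximalCyclic_fst hco.symm (MulEquiv.prodComm.trans e)
      P₂.isPGroup' P₁.isPGroup' h₂ hy x
    rwa [show MulEquiv.prodComm.trans e (y, 1) = y by simp [he]] at this
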